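/- Let $\mathcal C$ be a left proper pointed model category with functorial factorizations. (Pointed: $\mathcal C$ has a zero object $*$. Left proper: cobase changes of weak equivalences along cofibrations are weak equivalences. Right proper: base changes of weak equivalences along fibrations are weak equivalences.) An object $X$ is weakly contractible if $X\to *$ is a weak equivalence. Two morphisms of $\mathcal C$ are weakly equivalent if they are connected, in the category of arrows of $\mathcal C$, by a zigzag of commutative squares whose two horizontal maps are weak equivalences. The fibre of $p\colon X\to Y$ is $F_p=*\times_Y X$, and $[W,F]$ denotes the set of morphisms from $W$ to $F$ in the homotopy category $\mathcal C[\mathrm{weq}^{-1}]$; the trivial class is the image of the zero morphism. A cofibration $i\colon A\to B$ has an obstruction theory if there are an object $W$ and an assignment to every fibration $p\colon X\to Y$ and every commutative square $(a,b)\colon i\to p$ of a class $\alpha(p,a,b)\in[W,F_p]$ such that 1. the square $(a,b)\colon i\to p$ has a lift $B\to X$ if and only if $\alpha(p,a,b)$ is trivial; 2. for every commutative square $(f,g)\colon p\to p'$ between fibrations, $\alpha(p',fa,gb)$ is the composite of $\alpha(p,a,b)$ with the map $F_p\to F_{p'}$ induced by $(f,g)$. It has a fibrant obstruction theory if the same holds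 with all fibrations $p,p'$ restricted to those with fibrant target. Let $\mathcal K$ be the smallest class of cofibrations that contains all cofibrations with weakly contractible target and is closed under retract, weak equivalence (a cofibration weakly equivalent to a member is a member) and cobase change. Let the principal cofibrations be the smallest class of cofibrations that contains all cofibrations with weakly contractible target and is closed under weak equivalence and cobase change. **Theorem 7.2.** $\mathcal K$ is equal to the class of cofibrations that have a fibrant obstruction theory. If $\mathcal C$ is also right proper, then $\mathcal K$ is equal to the class of cofibrations that have an obstruction theory, and this class is equal to the class of retracts of principal cofibrations. -/

import Mathlib

open CategoryTheory CategoryTheory.Limits HomotopicalAlgebra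
open scoped ZeroObject

universe v u

namespace ObstructionTheory

section Proper

variable (C : Type u) [Category.{v} C] [ModelCategory C]

/-- A model category is left proper if every cobase change of a weak equivalence along a
cofibration is a weak equivalence. -/
class IsLeftProper : Prop where
  weakEquivalence_of_isPushout {A A' B B' : C} {f : A ⟶ A'} {i : A ⟶ B} {i' : A' ⟶ B'}
    {g : B ⟶ B'} (sq : IsPushout f i i' g) (hi : Cofibration i) (hf : WeakEquivalence f) :
    WeakEquivalence g

/-- A model category is right proper if every base change of a weak equivalence along a
fibration is a weak equivalence. -/
class IsRightProper : Prop where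
  weakEquivalence_of_isPullback {X X' Y Y' : C} {g : X' ⟶ X} {p' : X' ⟶ Y'} {p : X ⟶ Y}
    {f : Y' ⟶ Y} (sq : IsPullback g p' p f) (hp : Fibration p) (hf : WeakEquivalence f) :
    WeakEquivalence g

variable {C}

/-- Two morphisms are weakly equivalent if they are connected by a zigzag of levelwise weak
equivalences in the category of arrows (the intermediate arrows are arbitrary). -/
def WeaklyEquivalent {A B A' B' : C} (i : A ⟶ B) (i' : A' ⟶ B') : Prop :=
  Relation.EqvGen
    (fun f g : Arrow C => ∃ φ : f ⟶ g, WeakEquivalence φ.left ∧ WeakEquivalence φ.right)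
    (Arrow.mk i) (Arrow.mk i')

end Proper

section Pointed

variable {C : Type u} [Category.{v} C] [ModelCategory C] [HasZeroObject C] [HasZeroMorphisms C]

/-- An object is weakly contractible if its map to the zero object is a weak equivalence. -/
def IsWeaklyContractible (X : C) : Prop :=
  WeakEquivalence (0 : X ⟶ (0 : C))

variable (C) in
/-- The smallest class of cofibrations that contains the cofibrations with weakly contractible
target and is closed under weak equivalence (among cofibrations), cobase change and retract. -/
inductive generatedCofibrations : MorphismProperty C
  | of_isWeaklyContractible {A B : C} (i : A ⟶ B) (hi : Cofibration i)
      (hB : IsWeaklyContractible B) : generatedCofibrations i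
  | of_weaklyEquivalent {A B A' B' : C} (i : A ⟶ B) (i' : A' ⟶ B')
      (h : generatedCofibrations i) (hi' : Cofibration i') (e : WeaklyEquivalent i i') :
      generatedCofibrations i'
  | of_isPushout {A B A' B' : C} (f : A ⟶ A') (i : A ⟶ B) (i' : A' ⟶ B') (g : B ⟶ B')
      (h : generatedCofibrations i) (sq : IsPushout f i i' g) : generatedCofibrations i'
  | of_retract {A B A' B' : C} (i : A ⟶ B) (i' : A' ⟶ B')
      (h : generatedCofibrations i) (r : RetractArrow i' i) : generatedCofibrations i'

variable (C) in
/-- The principal cofibrations: the smallest class of cofibrations that contains the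
cofibrations with weakly contractible target and is closed under weak equivalence
(among cofibrations) and cobase change. -/
inductive principalCofibrations : MorphismProperty C
  | of_isWeaklyContractible {A B : C} (i : A ⟶ B) (hi : Cofibration i)
      (hB : IsWeaklyContractible B) : principalCofibrations i
  | of_weaklyEquivalent {A B A' B' : C} (i : A ⟶ B) (i' : A' ⟶ B')
      (h : principalCofibrations i) (hi' : Cofibration i') (e : WeaklyEquivalent i i') :
      principalCofibrations i'
  | of_isPushout {A B A' B' : C} (f : A ⟶ A') (i : A ⟶ B) (i' : A' ⟶ B') (g : B ⟶ B')
      (h : principalCofibrations i) (sq : IsPushout f i i' g) : principalCofibrations i'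

/-- An obstruction theory for `i`, with respect to the fibrations whose target satisfies `T`.
The fibre of `p` is `kernel p`, and weak homotopy classes are morphisms in the homotopy category,
i.e. the localization of `C` at the weak equivalences. -/
structure ObstructionData (T : ObjectProperty C) {A B : C} (i : A ⟶ B) where
  /-- the source of the obstruction classes -/
  W : C
  /-- the obstruction of a commutative square from `i` to a fibration `p` -/
  obs {X Y : C} (p : X ⟶ Y) (hp : Fibration p) (hY : T Y) (a : A ⟶ X) (b : B ⟶ Y)
    (sq : CommSq a i p b) :
    (weakEquivalences C).Q.obj W ⟶ (weakEquivalences C).Q.obj (kernel p)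
  /-- a lift exists if and only if the obstruction is the trivial class -/
  hasLift_iff {X Y : C} (p : X ⟶ Y) (hp : Fibration p) (hY : T Y) (a : A ⟶ X) (b : B ⟶ Y)
    (sq : CommSq a i p b) :
    sq.HasLift ↔ obs p hp hY a b sq = (weakEquivalences C).Q.map (0 : W ⟶ kernel p)
  /-- the obstruction is functorial in the fibration -/
  functorial {X Y X' Y' : C} (p : X ⟶ Y) (hp : Fibration p) (hY : T Y)
    (p' : X' ⟶ Y') (hp' : Fibration p') (hY' : T Y')
    (f : X ⟶ X') (g : Y ⟶ Y') (w : p ≫ g = f ≫ p')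
    (a : A ⟶ X) (b : B ⟶ Y) (sq : CommSq a i p b)
    (sq' : CommSq (a ≫ f) i p' (b ≫ g)) :
    obs p' hp' hY' (a ≫ f) (b ≫ g) sq' =
      obs p hp hY a b sq ≫ (weakEquivalences C).Q.map (kernel.map p p' f g w)

variable (C)

/-- The class of cofibrations that have an obstruction theory (for all fibrations). -/
def cofibrationsWithObstructionTheory : MorphismProperty C :=
  fun _ _ i => Cofibration i ∧ Nonempty (ObstructionData (fun _ => True) i)

/-- The class of cofibrations that have a fibrant obstruction theory, i.e. an obstruction theory
for all fibrations with fibrant target. -/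
def cofibrationsWithFibrantObstructionTheory : MorphismProperty C :=
  fun _ _ i => Cofibration i ∧ Nonempty (ObstructionData (fun Y => IsFibrant Y) i)

end Pointed

end ObstructionTheory

/-!
Write `F p` for the fibre `kernel p` of a fibration `p`.

The closure properties of the class of cofibrations with a fibrant obstruction theory carry one
inclusion. Lifting problems can be precomposed with a square `i ⟶ i'`, so obstruction theories pass
to retracts and cobase changes. A lifting problem does not notice a weak equivalence of cofibrations
(`exists_lift_of_weakEquivalence_left`, where left properness enters), nor one of fibrations
with fibrant target (`exists_lift_of_weakEquivalence_right`); moreover the latter induces a weak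
equivalence of fibres (`weakEquivalence_kernelMap`). Hence an obstruction theory for `i` gives one
for `i'` if `i ⟶ i'` is a weak equivalence. For the opposite direction
(`ObstructionOn.ofWeakEquivalence`), a lifting problem `i ⟶ p` is first replaced by one whose two
morphisms are cofibrations, then pushed out along `i ⟶ i'`, and finally made fibrant; the resulting
fibration is weakly equivalent to `p` and receives a map from `i'`. All replacements are
compatible with morphisms of lifting problems thanks to the functorial factorizations, which is
what makes the classes natural (`ObstructionOn.ofReplacement`).

The basic example is a cofibration `A ⟶ B` with `A` cofibrant and `B` weakly contractible. After
replacing `B ⟶ Y` by a fibration and base changing `p` along it, one may assume that `Y` is weakly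
contractible, in which case `F p ⟶ X` is a weak equivalence and the obstruction is the class of `A ⟶
X`: a null homotopy extends to `B` by homotopy extension (`LiftingProblem.solvable_iff_Q_map_eq`).

Conversely, an obstruction theory for `i : A ⟶ B` produces a retraction
(`ObstructionOn.mem_retracts_principalCofibrations`): factor `i` through a fibration `p : X ⟶ B`,
represent its obstruction by `W ⟶ F p ⟶ X`, and attach a cone on `W` to `X` along it. The result
is a principal cofibration under `X`, and by naturality the obstruction vanishes after the cone is
attached, so that the identity of `B` lifts. In the fibrant case `B` is first replaced by a fibrant
object.

In the right proper case every fibration is weakly equivalent, with weakly equivalent fibres, to one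
with fibrant target, so a fibrant obstruction theory extends to all fibrations
(`ObstructionOn.ofFibrant`).
-/

namespace ObstructionTheory

attribute [local simp] pullback.lift_fst pullback.lift_fst_assoc pullback.lift_snd
  pullback.lift_snd_assoc pushout.inl_desc pushout.inl_desc_assoc pushout.inr_desc
  pushout.inr_desc_assoc

section

/-! ### Base change of weak equivalences -/

section BaseChange

variable {C : Type u} [Category.{v} C] [ModelCategory C]

lemma trivialFibration_snd_of_isPullback {P X Y Z : C} {u : P ⟶ X} {q : P ⟶ Z} {p : X ⟶ Y}
    {f : Z ⟶ Y} (h : IsPullback u q p f) [Fibration p] [WeakEquivalence p] :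
    Fibration q ∧ WeakEquivalence q := by
  have := MorphismProperty.of_isPullback (P := trivialFibrations C) h (mem_trivialFibrations p)
  exact (mem_trivialFibrations_iff q).1 this

lemma fibration_snd_of_isPullback {P X Y Z : C} {u : P ⟶ X} {q : P ⟶ Z} {p : X ⟶ Y}
    {f : Z ⟶ Y} (h : IsPullback u q p f) [Fibration p] : Fibration q :=
  (fibration_iff q).2 (MorphismProperty.of_isPullback (P := fibrations C) h (mem_fibrations p))

lemma fibrant_of_fibration {X Y : C} (p : X ⟶ Y) (hp : Fibration p) (hY : IsFibrant Y) :
    IsFibrant X :=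
  isFibrant_of_fibration p

/-- Base change preserves weak equivalences between fibrations over a fixed object: this is
Ken Brown's factorization over that object. -/
lemma weakEquivalence_of_isPullback_over {X X' Y Z P P' : C} {p : X ⟶ Y} {p' : X' ⟶ Y}
    {e : X ⟶ X'} (w : e ≫ p' = p) [Fibration p] [Fibration p'] [WeakEquivalence e]
    {f : Z ⟶ Y} {u : P ⟶ X} {q : P ⟶ Z} {u' : P' ⟶ X'} {q' : P' ⟶ Z}
    (h : IsPullback u q p f) (h' : IsPullback u' q' p' f)
    (k : P ⟶ P') (hk : k ≫ u' = u ≫ e) (hk' : k ≫ q' = q) : WeakEquivalence k := by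
  let d := MorphismProperty.factorizationData (trivialCofibrations C) (fibrations C)
    (pullback.lift e (𝟙 X) (by simpa using w) : X ⟶ pullback p' p)
  let t : d.Z ⟶ X' := d.p ≫ pullback.fst _ _
  let r : d.Z ⟶ X := d.p ≫ pullback.snd _ _
  have ht : d.i ≫ t = e := by simp [t]
  have hr : d.i ≫ r = 𝟙 X := by simp [r]
  have htr : t ≫ p' = r ≫ p := by simp [t, r, pullback.condition]
  have : Fibration t := by dsimp [t]; infer_instance
  have : Fibration r := by dsimp [r]; infer_instance
  have : WeakEquivalence t := weakEquivalence_of_precomp_of_fac ht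
  have : WeakEquivalence r := weakEquivalence_of_precomp_of_fac hr
  have hR := IsPullback.of_hasPullback (r ≫ p) f
  let v : pullback (r ≫ p) f ⟶ P := h.lift (pullback.fst _ _ ≫ r) (pullback.snd _ _)
    (by simpa using pullback.condition)
  let v' : pullback (r ≫ p) f ⟶ P' := h'.lift (pullback.fst _ _ ≫ t) (pullback.snd _ _)
    (by simpa [htr] using pullback.condition)
  have hv : IsPullback (pullback.fst (r ≫ p) f) v r u :=
    (IsPullback.of_bot (by simpa [v] using hR) (by simp [v]) h)
  have hv' : IsPullback (pullback.fst (r ≫ p) f) v' t u' :=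
    (IsPullback.of_bot (by simpa [v', htr] using hR) (by simp [v']) h')
  obtain ⟨_, _⟩ := trivialFibration_snd_of_isPullback hv
  obtain ⟨_, _⟩ := trivialFibration_snd_of_isPullback hv'
  let s : P ⟶ pullback (r ≫ p) f := pullback.lift (u ≫ d.i) q
    (by rw [Category.assoc, reassoc_of% hr, h.w])
  have hs : s ≫ v = 𝟙 P := h.hom_ext (by simp [s, v, hr]) (by simp [s, v])
  have hs' : s ≫ v' = k := h'.hom_ext (by simp [s, v', hk, ht]) (by simp [s, v', hk'])
  have : WeakEquivalence s := weakEquivalence_of_postcomp_of_fac hs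
  rw [← hs']
  infer_instance

/-- In every model category, the base change of a weak equivalence between fibrant objects along
a fibration is a weak equivalence. By Ken Brown's factorization it suffices to treat a section
`h.i` of a trivial fibration `h.r`; up to weak equivalence every fibration over the source of `h.r`
is a base change along `h.r`, and pulling that back along `h.i` gives back the original. -/
lemma weakEquivalence_of_isPullback_of_isFibrant {X X' Y Y' : C} {g : X' ⟶ X} {p' : X' ⟶ Y'}
    {p : X ⟶ Y} {f : Y' ⟶ Y} (sq : IsPullback g p' p f) (hp : Fibration p)
    (hf : WeakEquivalence f) (hY : IsFibrant Y) (hY' : IsFibrant Y') : WeakEquivalence g := by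
  obtain ⟨h⟩ : Nonempty (FibrantBrownFactorization f) := inferInstance
  have : WeakEquivalence h.p := weakEquivalence_of_precomp_of_fac h.fac
  have : WeakEquivalence h.r := weakEquivalence_of_precomp_of_fac h.i_r
  have := h.fibration_r
  let q : pullback p h.p ⟶ h.Z := pullback.snd _ _
  let m : X' ⟶ pullback p h.p := pullback.lift g (p' ≫ h.i) (by simp [sq.w])
  have hm : IsPullback m p' q h.i :=
    IsPullback.of_right (by simpa [m] using sq) (by simp [m, q])
      (IsPullback.of_hasPullback p h.p)
  let d := MorphismProperty.factorizationData (trivialCofibrations C) (fibrations C) (q ≫ h.r)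
  let n : pullback p h.p ⟶ pullback d.p h.r := pullback.lift d.i q (by simp)
  have hn : n ≫ pullback.fst _ _ = d.i := by simp [n]
  have : WeakEquivalence n := weakEquivalence_of_postcomp_of_fac hn
  let c : d.Z ⟶ pullback d.p h.r := pullback.lift (𝟙 _) (d.p ≫ h.i) (by simp [h.i_r])
  -- The base change of `d.p` along `h.r` and then along `h.i` is `d.p` again.
  have hc : IsPullback c d.p (pullback.snd d.p h.r) h.i := by
    refine IsPullback.of_right ?_ (by simp [c]) (IsPullback.of_hasPullback d.p h.r)
    rw [h.i_r]
    simpa [c] using IsPullback.of_horiz_isIso ⟨by simp⟩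
  have hmd : m ≫ d.i ≫ d.p = p' := by
    rw [d.fac, ← Category.assoc, hm.w, Category.assoc, h.i_r, Category.comp_id]
  have hk : WeakEquivalence (m ≫ d.i) := by
    refine weakEquivalence_of_isPullback_over (e := n) (p := q) (p' := pullback.snd d.p h.r)
      (by simp [n]) hm hc _ ?_ (by simpa using hmd)
    apply pullback.hom_ext
    · simp [c, n]
    · simp only [c, n, Category.assoc, pullback.lift_snd, hm.w]
      rw [← reassoc_of% hmd]
  have : WeakEquivalence m := weakEquivalence_of_postcomp m d.i
  have hg : m ≫ pullback.fst _ _ = g := by simp [m]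
  rw [← hg]
  infer_instance

lemma weakEquivalence_inl_pushout [IsLeftProper C] {X Y Z : C} (f : X ⟶ Y) (g : X ⟶ Z)
    [Cofibration f] [WeakEquivalence g] : WeakEquivalence (pushout.inl f g) :=
  IsLeftProper.weakEquivalence_of_isPushout (IsPushout.of_hasPushout f g).flip
    inferInstance inferInstance

end BaseChange

/-! ### Invariance of lifting problems -/

section Lifting

variable {C : Type u} [Category.{v} C] [ModelCategory C]

/-- Lifting problems against a fibration do not change when the fibration is replaced by a weakly
equivalent one, provided that the base change of the target fibration along the map of bases is
still a weak equivalence. -/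
lemma exists_lift_of_weakEquivalence_right {A B X Y X' Y' : C} {i : A ⟶ B} [Cofibration i]
    {p : X ⟶ Y} {p' : X' ⟶ Y'} [Fibration p] [Fibration p'] {f : X ⟶ X'} {g : Y ⟶ Y'}
    (w : p ≫ g = f ≫ p') [WeakEquivalence f] [WeakEquivalence (pullback.fst p' g)]
    {a : A ⟶ X} {b : B ⟶ Y} (sq : a ≫ p = i ≫ b)
    (l : B ⟶ X') (hl : i ≫ l = a ≫ f) (hl' : l ≫ p' = b ≫ g) :
    ∃ m : B ⟶ X, i ≫ m = a ∧ m ≫ p = b := by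
  let e : X ⟶ pullback p' g := pullback.lift f p w.symm
  have he : e ≫ pullback.fst _ _ = f := by simp [e]
  have he' : e ≫ pullback.snd _ _ = p := by simp [e]
  have : WeakEquivalence e := weakEquivalence_of_postcomp_of_fac he
  let d := MorphismProperty.factorizationData (trivialCofibrations C) (fibrations C) e
  have : WeakEquivalence d.p := weakEquivalence_of_precomp_of_fac d.fac
  have sq₁ : CommSq (a ≫ d.i) i d.p (pullback.lift l b hl') := ⟨by
    apply pullback.hom_ext
    · simp [he, hl]
    · simp [he', sq]⟩
  have sq₂ : CommSq (𝟙 X) d.i p (d.p ≫ pullback.snd _ _) := ⟨by simp [he']⟩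
  refine ⟨sq₁.lift ≫ sq₂.lift, ?_, ?_⟩
  · rw [sq₁.fac_left_assoc, Category.assoc, sq₂.fac_left, Category.comp_id]
  · rw [Category.assoc, sq₂.fac_right, sq₁.fac_right_assoc, pullback.lift_snd]

/-- In a left proper model category, lifting problems for a cofibration do not change when the
cofibration is replaced by a weakly equivalent one. -/
lemma exists_lift_of_weakEquivalence_left [IsLeftProper C] {A B A' B' X Y : C} {i : A ⟶ B}
    {i' : A' ⟶ B'} [Cofibration i] [Cofibration i'] {u : A ⟶ A'} {v : B ⟶ B'}
    (w : i ≫ v = u ≫ i') [WeakEquivalence u] [WeakEquivalence v]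
    {p : X ⟶ Y} [Fibration p] {a : A' ⟶ X} {b : B' ⟶ Y} (sq : a ≫ p = i' ≫ b)
    (l : B ⟶ X) (hl : i ≫ l = u ≫ a) (hl' : l ≫ p = v ≫ b) :
    ∃ m : B' ⟶ X, i' ≫ m = a ∧ m ≫ p = b := by
  let e : pushout i u ⟶ B' := pushout.desc v i' w
  have he : pushout.inl _ _ ≫ e = v := by simp [e]
  have he' : pushout.inr _ _ ≫ e = i' := by simp [e]
  have := weakEquivalence_inl_pushout i u
  have : WeakEquivalence e := weakEquivalence_of_precomp_of_fac he
  let d := MorphismProperty.factorizationData (cofibrations C) (trivialFibrations C) e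
  have : WeakEquivalence d.i := weakEquivalence_of_postcomp_of_fac d.fac
  have sq₁ : CommSq (pushout.desc l a hl) d.i p (d.p ≫ b) := ⟨by
    apply pushout.hom_ext
    · simp [hl', reassoc_of% he]
    · simp [reassoc_of% he', sq]⟩
  have sq₂ : CommSq (pushout.inr _ _ ≫ d.i) i' d.p (𝟙 B') := ⟨by simp [he']⟩
  refine ⟨sq₂.lift ≫ sq₁.lift, ?_, ?_⟩
  · rw [sq₂.fac_left_assoc, Category.assoc, sq₁.fac_left, pushout.inr_desc]
  · rw [Category.assoc, sq₁.fac_right, sq₂.fac_right_assoc, Category.id_comp]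

end Lifting

end

section

/-! ### Lifting problems -/

section

variable {C : Type u} [Category.{v} C]

/-- A commutative square from `i` to a morphism `p`. -/
structure LiftingProblem {A B : C} (i : A ⟶ B) where
  {X Y : C}
  /-- the morphism against which `i` is lifted -/
  p : X ⟶ Y
  /-- the top morphism of the square -/
  a : A ⟶ X
  /-- the bottom morphism of the square -/
  b : B ⟶ Y
  w : a ≫ p = i ≫ b

namespace LiftingProblem

variable {A B : C} {i : A ⟶ B}

/-- A morphism of lifting problems: a commutative square between the right-hand sides that is
compatible with the maps from `i`. -/
structure Hom (s t : LiftingProblem i) where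
  f : s.X ⟶ t.X
  g : s.Y ⟶ t.Y
  w : s.p ≫ g = f ≫ t.p
  wa : s.a ≫ f = t.a
  wb : s.b ≫ g = t.b

/-- The existence of a lift. -/
def Solvable (s : LiftingProblem i) : Prop :=
  ∃ l : B ⟶ s.X, i ≫ l = s.a ∧ l ≫ s.p = s.b

lemma commSq (s : LiftingProblem i) : CommSq s.a i s.p s.b := ⟨s.w⟩

lemma solvable_iff_hasLift (s : LiftingProblem i) : s.Solvable ↔ s.commSq.HasLift :=
  ⟨fun ⟨l, h₁, h₂⟩ => ⟨⟨⟨l, h₁, h₂⟩⟩⟩, fun _ => ⟨s.commSq.lift, by simp, by simp⟩⟩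

lemma Hom.solvable {s t : LiftingProblem i} (φ : s.Hom t) : s.Solvable → t.Solvable :=
  fun ⟨l, h₁, h₂⟩ => ⟨l ≫ φ.f, by rw [reassoc_of% h₁, φ.wa],
    by rw [Category.assoc, ← φ.w, reassoc_of% h₂, φ.wb]⟩

/-- The lifting problem for `i` obtained by composing one for `i'` with a square from `i`
to `i'`. -/
abbrev precomp {A' B' : C} {i' : A' ⟶ B'} (s : LiftingProblem i') (u : A ⟶ A') (v : B ⟶ B')
    (w : i ≫ v = u ≫ i') : LiftingProblem i where
  X := s.X
  Y := s.Y
  p := s.p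
  a := u ≫ s.a
  b := v ≫ s.b
  w := by rw [Category.assoc, s.w, reassoc_of% w]

lemma Solvable.precomp {A' B' : C} {i' : A' ⟶ B'} {s : LiftingProblem i'} (h : s.Solvable)
    (u : A ⟶ A') (v : B ⟶ B') (w : i ≫ v = u ≫ i') : (s.precomp u v w).Solvable := by
  obtain ⟨l, h₁, h₂⟩ := h
  exact ⟨v ≫ l, by rw [reassoc_of% w, h₁], by rw [Category.assoc, h₂]⟩

end LiftingProblem

end

namespace LiftingProblem

variable {C : Type u} [Category.{v} C] [ModelCategory C] {A B : C} {i : A ⟶ B}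

/-- Solvability does not change along a weak equivalence of fibrations for which the base change of
the target fibration along `φ.g` is still a weak equivalence. -/
lemma Hom.solvable_iff {s t : LiftingProblem i} (φ : s.Hom t) [Cofibration i] [Fibration s.p]
    [Fibration t.p] [WeakEquivalence φ.f] [WeakEquivalence (pullback.fst t.p φ.g)] :
    s.Solvable ↔ t.Solvable :=
  ⟨φ.solvable, fun ⟨l, h₁, h₂⟩ => exists_lift_of_weakEquivalence_right φ.w s.w l
    (by rw [h₁, φ.wa]) (by rw [h₂, φ.wb])⟩

/-- In a left proper model category, a weak equivalence between cofibrations does not affect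
solvability. -/
lemma solvable_precomp_iff [IsLeftProper C] {A' B' : C} {i' : A' ⟶ B'} [Cofibration i]
    [Cofibration i'] (s : LiftingProblem i') [Fibration s.p] (u : A ⟶ A') (v : B ⟶ B')
    (w : i ≫ v = u ≫ i') [WeakEquivalence u] [WeakEquivalence v] :
    (s.precomp u v w).Solvable ↔ s.Solvable :=
  ⟨fun ⟨l, h₁, h₂⟩ => exists_lift_of_weakEquivalence_left w s.w l h₁ h₂, fun h => h.precomp u v w⟩

end LiftingProblem

variable {C : Type u} [Category.{v} C] [ModelCategory C] [HasZeroMorphisms C]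

/-! ### Fibres -/

section Fibres

variable [HasZeroObject C]

lemma isPullback_kernel {X Y : C} (p : X ⟶ Y) :
    IsPullback (kernel.ι p) (0 : kernel p ⟶ (0 : C)) p 0 :=
  ⟨⟨by simp⟩, ⟨PullbackCone.IsLimit.mk _
    (fun s => kernel.lift p s.fst (by rw [s.condition, comp_zero]))
    (fun s => by simp) (fun s => (isZero_zero C).eq_of_tgt _ _)
    (fun s m hm _ => by
      rw [← cancel_mono (kernel.ι p)]
      simpa using hm)⟩⟩

/-- A weak equivalence between fibrations induces a weak equivalence of fibres, provided that the
base change of the target fibration along the map of bases is still a weak equivalence. -/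
lemma weakEquivalence_kernelMap {X Y X' Y' : C} {p : X ⟶ Y} {p' : X' ⟶ Y'} [Fibration p]
    [Fibration p'] {f : X ⟶ X'} {g : Y ⟶ Y'} (w : p ≫ g = f ≫ p') [WeakEquivalence f]
    [WeakEquivalence (pullback.fst p' g)] : WeakEquivalence (kernel.map p p' f g w) := by
  have he : pullback.lift f p w.symm ≫ pullback.fst p' g = f := by simp
  have : WeakEquivalence (pullback.lift f p w.symm) := weakEquivalence_of_postcomp_of_fac he
  have h : IsPullback (pullback.lift (kernel.ι p') 0 (by simp)) (0 : kernel p' ⟶ (0 : C))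
      (pullback.snd p' g) 0 :=
    IsPullback.of_right (by simpa using isPullback_kernel p') (by simp)
      (IsPullback.of_hasPullback p' g)
  refine weakEquivalence_of_isPullback_over (e := pullback.lift f p w.symm)
    (by simp) (isPullback_kernel p) h _ ?_ ((isZero_zero C).eq_of_tgt _ _)
  apply pullback.hom_ext <;> simp

lemma isFibrant_iff_fibration_zero (X : C) : IsFibrant X ↔ Fibration (0 : X ⟶ (0 : C)) :=
  isFibrant_iff_of_isTerminal _ HasZeroObject.zeroIsTerminal

lemma isFibrant_zero : IsFibrant (0 : C) :=
  (isFibrant_iff_fibration_zero _).2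
    (by rw [(isZero_zero C).eq_of_tgt (0 : (0 : C) ⟶ 0) (𝟙 _)]; infer_instance)

lemma isFibrant_kernel {X Y : C} (p : X ⟶ Y) [Fibration p] : IsFibrant (kernel p) :=
  (isFibrant_iff_fibration_zero _).2 (fibration_snd_of_isPullback (isPullback_kernel p))

lemma weakEquivalence_zero_of_isWeaklyContractible {Y : C} (hY : IsWeaklyContractible Y) :
    WeakEquivalence (0 : (0 : C) ⟶ Y) := by
  have : WeakEquivalence (0 : Y ⟶ (0 : C)) := hY
  exact weakEquivalence_of_postcomp_of_fac (g := (0 : Y ⟶ (0 : C)))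
    (show _ = 𝟙 _ from (isZero_zero C).eq_of_tgt _ _)

lemma isWeaklyContractible_of_weakEquivalence {X Y : C} (f : X ⟶ Y) [WeakEquivalence f]
    (hY : IsWeaklyContractible Y) : IsWeaklyContractible X := by
  have : WeakEquivalence (0 : Y ⟶ (0 : C)) := hY
  have : WeakEquivalence (f ≫ (0 : Y ⟶ (0 : C))) := inferInstance
  rwa [comp_zero] at this

lemma isWeaklyContractible_of_weakEquivalence' {X Y : C} (f : X ⟶ Y) [WeakEquivalence f]
    (hX : IsWeaklyContractible X) : IsWeaklyContractible Y := by
  have : WeakEquivalence (0 : X ⟶ (0 : C)) := hX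
  exact weakEquivalence_of_precomp_of_fac (f := f) (show f ≫ 0 = 0 by simp)

end Fibres

/-! ### The homotopy category -/

section HomotopyCategory

instance isIso_Q_map {X Y : C} (f : X ⟶ Y) [WeakEquivalence f] :
    IsIso ((weakEquivalences C).Q.map f) :=
  Localization.inverts (weakEquivalences C).Q (weakEquivalences C) f (mem_weakEquivalences f)

variable [HasZeroObject C]

/-- A morphism out of a weakly contractible object is trivial in the homotopy category. -/
lemma Q_map_eq_of_isWeaklyContractible {X Y : C} (hX : IsWeaklyContractible X) (f : X ⟶ Y) :
    (weakEquivalences C).Q.map f = (weakEquivalences C).Q.map 0 := by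
  have : WeakEquivalence (0 : (0 : C) ⟶ X) := weakEquivalence_zero_of_isWeaklyContractible hX
  rw [← cancel_epi ((weakEquivalences C).Q.map (0 : (0 : C) ⟶ X)), ← Functor.map_comp,
    ← Functor.map_comp, zero_comp, comp_zero]

end HomotopyCategory

/-! ### Obstruction theories -/

/-- The map of fibres induced by a morphism of lifting problems. -/
noncomputable abbrev LiftingProblem.Hom.kernelMap {A B : C} {i : A ⟶ B}
    {s t : LiftingProblem i} (φ : s.Hom t) : kernel s.p ⟶ kernel t.p :=
  kernel.map s.p t.p φ.f φ.g φ.w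

/-- An obstruction theory for the lifting problems of `i` that satisfy `T`. In contrast to
`ObstructionData`, the condition `T` may involve the whole square. -/
structure ObstructionOn {A B : C} {i : A ⟶ B} (T : LiftingProblem i → Prop) where
  /-- the source of the obstruction classes -/
  W : C
  /-- the obstruction class of a lifting problem -/
  obs (s : LiftingProblem i) (hs : T s) :
    (weakEquivalences C).Q.obj W ⟶ (weakEquivalences C).Q.obj (kernel s.p)
  solvable_iff (s : LiftingProblem i) (hs : T s) :
    s.Solvable ↔ obs s hs = (weakEquivalences C).Q.map 0
  functorial {s t : LiftingProblem i} (φ : s.Hom t) (hs : T s) (ht : T t) :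
    obs t ht = obs s hs ≫ (weakEquivalences C).Q.map φ.kernelMap

/-- The lifting problems against a fibration whose target satisfies `T`. -/
def fibrationProblems (T : ObjectProperty C) {A B : C} (i : A ⟶ B) : LiftingProblem i → Prop :=
  fun s => Fibration s.p ∧ T s.Y

section

variable {A B : C} {i : A ⟶ B}

/-- An obstruction theory in the sense of `ObstructionData` is one for the lifting problems against
fibrations. -/
def ObstructionData.toObstructionOn {T : ObjectProperty C} (O : ObstructionData T i) :
    ObstructionOn (fibrationProblems T i) where
  W := O.W
  obs s hs := O.obs s.p hs.1 hs.2 s.a s.b s.commSq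
  solvable_iff s hs := by rw [s.solvable_iff_hasLift, O.hasLift_iff _ hs.1 hs.2]
  functorial := by
    rintro ⟨p, a, b, w⟩ ⟨p', a', b', w'⟩ ⟨f, g, hw, wa, wb⟩ hs ht
    dsimp only at f g hw wa wb
    subst wa wb
    exact O.functorial p hs.1 hs.2 p' ht.1 ht.2 f g hw a b ⟨w⟩ ⟨w'⟩

/-- The converse of `ObstructionData.toObstructionOn`. -/
def ObstructionOn.toObstructionData {T : ObjectProperty C}
    (O : ObstructionOn (fibrationProblems T i)) : ObstructionData T i where
  W := O.W
  obs p hp hY a b sq := O.obs ⟨p, a, b, sq.w⟩ ⟨hp, hY⟩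
  hasLift_iff p hp hY a b sq := by
    rw [← O.solvable_iff ⟨p, a, b, sq.w⟩ ⟨hp, hY⟩, LiftingProblem.solvable_iff_hasLift]
  functorial p hp hY p' hp' hY' f g w a b sq sq' :=
    O.functorial (s := ⟨p, a, b, sq.w⟩) (t := ⟨p', _, _, sq'.w⟩) ⟨f, g, w, rfl, rfl⟩ _ _

lemma nonempty_obstructionData_iff {T : ObjectProperty C} :
    Nonempty (ObstructionData T i) ↔ Nonempty (ObstructionOn (fibrationProblems T i)) :=
  ⟨fun ⟨O⟩ => ⟨O.toObstructionOn⟩, fun ⟨O⟩ => ⟨O.toObstructionData⟩⟩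

namespace ObstructionOn

/-- An obstruction theory is inherited along a square `(u, v) : i ⟶ i'` that does not affect
solvability. -/
def precomp {A' B' : C} {i' : A' ⟶ B'} {T : LiftingProblem i → Prop}
    {T' : LiftingProblem i' → Prop} (O : ObstructionOn T) (u : A ⟶ A') (v : B ⟶ B')
    (w : i ≫ v = u ≫ i') (hT : ∀ s, T' s → T (s.precomp u v w))
    (h : ∀ s, T' s → (s.precomp u v w).Solvable → s.Solvable) : ObstructionOn T' where
  W := O.W
  obs s hs := O.obs (s.precomp u v w) (hT s hs)
  solvable_iff s hs := by
    refine Iff.trans ⟨fun h' => h'.precomp u v w, h s hs⟩ (O.solvable_iff _ _)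
  functorial {s t} φ hs ht :=
    O.functorial (s := s.precomp u v w) (t := t.precomp u v w)
      ⟨φ.f, φ.g, φ.w, by rw [Category.assoc, φ.wa], by rw [Category.assoc, φ.wb]⟩ _ _

/-- Obstruction classes can be computed after replacing every lifting problem `s` for `i` by a
lifting problem `R s` for `i'`, when `s.p` maps to `(R s).p` by a weak equivalence on fibres.
The replacement has to be compatible with morphisms, but it need not be a functor. -/
noncomputable def ofReplacement {A' B' : C} {i' : A' ⟶ B'} {T : LiftingProblem i → Prop}
    {T' : LiftingProblem i' → Prop} (O : ObstructionOn T')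
    (R : LiftingProblem i → LiftingProblem i') (hR : ∀ s, T s → T' (R s))
    (f : ∀ s, s.X ⟶ (R s).X) (g : ∀ s, s.Y ⟶ (R s).Y) (w : ∀ s, s.p ≫ g s = f s ≫ (R s).p)
    (hw : ∀ s, T s → WeakEquivalence (kernel.map s.p (R s).p (f s) (g s) (w s)))
    (h : ∀ s, T s → (s.Solvable ↔ (R s).Solvable))
    (hφ : ∀ {s t : LiftingProblem i} (φ : s.Hom t), T s → T t →
      ∃ ψ : (R s).Hom (R t), φ.f ≫ f t = f s ≫ ψ.f) : ObstructionOn T where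
  W := O.W
  obs s hs :=
    have := hw s hs
    O.obs (R s) (hR s hs) ≫
      inv ((weakEquivalences C).Q.map (kernel.map s.p (R s).p (f s) (g s) (w s)))
  solvable_iff s hs := by
    have := hw s hs
    rw [h s hs, O.solvable_iff _ (hR s hs), IsIso.comp_inv_eq, ← Functor.map_comp, zero_comp]
  functorial {s t} φ hs ht := by
    have := hw s hs
    have := hw t ht
    obtain ⟨ψ, hψ⟩ := hφ φ hs ht
    have e : φ.kernelMap ≫ kernel.map t.p (R t).p (f t) (g t) (w t) =
        kernel.map s.p (R s).p (f s) (g s) (w s) ≫ ψ.kernelMap := by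
      rw [← cancel_mono (kernel.ι _)]
      simp [hψ]
    rw [IsIso.comp_inv_eq, O.functorial ψ (hR s hs) (hR t ht), Category.assoc, Category.assoc,
      ← Functor.map_comp, e, Functor.map_comp, IsIso.inv_hom_id_assoc]

/-- The variant of `ofReplacement` in which `(R s).p` maps to `s.p` by a weak equivalence
on fibres. -/
noncomputable def ofReplacement' {A' B' : C} {i' : A' ⟶ B'} {T : LiftingProblem i → Prop}
    {T' : LiftingProblem i' → Prop} (O : ObstructionOn T')
    (R : LiftingProblem i → LiftingProblem i') (hR : ∀ s, T s → T' (R s))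
    (f : ∀ s, (R s).X ⟶ s.X) (g : ∀ s, (R s).Y ⟶ s.Y) (w : ∀ s, (R s).p ≫ g s = f s ≫ s.p)
    (hw : ∀ s, T s → WeakEquivalence (kernel.map (R s).p s.p (f s) (g s) (w s)))
    (h : ∀ s, T s → (s.Solvable ↔ (R s).Solvable))
    (hφ : ∀ {s t : LiftingProblem i} (φ : s.Hom t), T s → T t →
      ∃ ψ : (R s).Hom (R t), ψ.f ≫ f t = f s ≫ φ.f) : ObstructionOn T where
  W := O.W
  obs s hs := O.obs (R s) (hR s hs) ≫
    (weakEquivalences C).Q.map (kernel.map (R s).p s.p (f s) (g s) (w s))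
  solvable_iff s hs := by
    have := hw s hs
    rw [h s hs, O.solvable_iff _ (hR s hs),
      ← cancel_mono ((weakEquivalences C).Q.map (kernel.map (R s).p s.p (f s) (g s) (w s))),
      ← Functor.map_comp, zero_comp]
  functorial {s t} φ hs ht := by
    obtain ⟨ψ, hψ⟩ := hφ φ hs ht
    have e : ψ.kernelMap ≫ kernel.map (R t).p t.p (f t) (g t) (w t) =
        kernel.map (R s).p s.p (f s) (g s) (w s) ≫ φ.kernelMap := by
      rw [← cancel_mono (kernel.ι _)]
      simp [hψ]
    rw [O.functorial ψ (hR s hs) (hR t ht), Category.assoc, Category.assoc,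
      ← Functor.map_comp, ← Functor.map_comp, e]

end ObstructionOn

end

end

section

variable {C : Type u} [Category.{v} C] [ModelCategory C] [HasZeroObject C] [HasZeroMorphisms C]

/-! ### Cofibrations with weakly contractible target -/

section ContractibleTarget

variable {A B : C} {i : A ⟶ B}

lemma weakEquivalence_kernel_ι {X Y : C} (p : X ⟶ Y) [Fibration p] (hY : IsFibrant Y)
    (hY' : IsWeaklyContractible Y) : WeakEquivalence (kernel.ι p) :=
  weakEquivalence_of_isPullback_of_isFibrant (isPullback_kernel p) inferInstance
    (weakEquivalence_zero_of_isWeaklyContractible hY') hY isFibrant_zero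

/-- A lifting problem for a cofibration with cofibrant source and weakly contractible target,
against a fibration with fibrant and weakly contractible target, is solvable if and only if its
top morphism is trivial in the homotopy category. -/
lemma LiftingProblem.solvable_iff_Q_map_eq [Cofibration i] [IsCofibrant A]
    (hB : IsWeaklyContractible B) (s : LiftingProblem i) (hp : Fibration s.p)
    (hY : IsFibrant s.Y) (hY' : IsWeaklyContractible s.Y) :
    s.Solvable ↔ (weakEquivalences C).Q.map s.a = (weakEquivalences C).Q.map 0 := by
  constructor
  · rintro ⟨l, h, _⟩
    rw [← h, Functor.map_comp, Q_map_eq_of_isWeaklyContractible hB l, ← Functor.map_comp,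
      comp_zero]
  · intro h
    have hX : IsFibrant s.X := fibrant_of_fibration s.p hp hY
    obtain ⟨P, _, ⟨H⟩⟩ :=
      ((RightHomotopyRel.iff_map_eq (weakEquivalences C).Q _ _).2 h.symm).exists_good_pathObject
    obtain ⟨l, H', hl⟩ := H.homotopy_extension i (0 : B ⟶ s.X) (by simp)
    have : WeakEquivalence (0 : s.Y ⟶ (0 : C)) := hY'
    have : Fibration (0 : s.X ⟶ (0 : C)) := (isFibrant_iff_fibration_zero _).1 hX
    have : WeakEquivalence (pullback.fst (0 : s.X ⟶ (0 : C)) (0 : s.Y ⟶ (0 : C))) :=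
      weakEquivalence_of_isPullback_of_isFibrant (IsPullback.of_hasPullback _ _)
        this inferInstance isFibrant_zero hY
    -- `l` need not lie over `s.Y`, which is repaired by comparing `s.p` with `s.X ⟶ 0`.
    refine exists_lift_of_weakEquivalence_right (p' := (0 : s.X ⟶ (0 : C)))
      (g := (0 : s.Y ⟶ (0 : C))) (f := 𝟙 s.X) (by simp) s.w l ?_ (by simp)
    rw [Category.comp_id, ← H'.h₁, ← Category.assoc, hl, H.h₁]

/-- For a cofibration `A ⟶ B` with cofibrant source and weakly contractible target, the
obstruction against a fibration with contractible fibrant target is given by the top morphism,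
because the inclusion of the fibre is a weak equivalence. -/
noncomputable def obstructionOnContractible [Cofibration i] [IsCofibrant A]
    (hB : IsWeaklyContractible B) :
    ObstructionOn (fibrationProblems (fun Y => IsFibrant Y ∧ IsWeaklyContractible Y) i) where
  W := A
  obs s hs :=
    have := hs.1
    have := weakEquivalence_kernel_ι s.p hs.2.1 hs.2.2
    (weakEquivalences C).Q.map s.a ≫ inv ((weakEquivalences C).Q.map (kernel.ι s.p))
  solvable_iff s hs := by
    have := hs.1
    have := weakEquivalence_kernel_ι s.p hs.2.1 hs.2.2
    rw [s.solvable_iff_Q_map_eq hB hs.1 hs.2.1 hs.2.2, IsIso.comp_inv_eq, ← Functor.map_comp,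
      zero_comp]
  functorial {s t} φ hs ht := by
    have := hs.1
    have := ht.1
    have := weakEquivalence_kernel_ι s.p hs.2.1 hs.2.2
    have := weakEquivalence_kernel_ι t.p ht.2.1 ht.2.2
    have e : φ.kernelMap ≫ kernel.ι t.p = kernel.ι s.p ≫ φ.f := by simp
    rw [IsIso.comp_inv_eq, Category.assoc, Category.assoc, ← Functor.map_comp, e,
      Functor.map_comp, IsIso.inv_hom_id_assoc, ← Functor.map_comp, φ.wa]

variable [(trivialCofibrations C).HasFunctorialFactorization (fibrations C)]

variable (C) in
/-- The chosen functorial factorization into a trivial cofibration and a fibration. -/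
noncomputable abbrev fibFactorization :
    MorphismProperty.FunctorialFactorizationData (trivialCofibrations C) (fibrations C) :=
  MorphismProperty.functorialFactorizationData _ _

/-- The base change of a lifting problem along the fibration that replaces its bottom
morphism. -/
noncomputable abbrev LiftingProblem.pullbackProblem (s : LiftingProblem i) : LiftingProblem i where
  X := pullback s.p ((fibFactorization C).factorizationData s.b).p
  Y := ((fibFactorization C).factorizationData s.b).Z
  p := pullback.snd _ _
  a := pullback.lift s.a (i ≫ ((fibFactorization C).factorizationData s.b).i) (by simp [s.w])
  b := ((fibFactorization C).factorizationData s.b).i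
  w := by simp

/-- A cofibration with cofibrant source and weakly contractible target has a fibrant
obstruction theory. -/
noncomputable def obstructionOnOfIsWeaklyContractible [Cofibration i] [IsCofibrant A]
    (hB : IsWeaklyContractible B) : ObstructionOn (fibrationProblems (fun Y => IsFibrant Y) i) :=
  (obstructionOnContractible hB).ofReplacement' LiftingProblem.pullbackProblem
    (fun s hs => by
      have := hs.1
      exact ⟨inferInstance, fibrant_of_fibration ((fibFactorization C).factorizationData s.b).p
        inferInstance hs.2, isWeaklyContractible_of_weakEquivalence'
          ((fibFactorization C).factorizationData s.b).i hB⟩)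
    (fun s => pullback.fst _ _) (fun s => ((fibFactorization C).factorizationData s.b).p)
    (fun s => pullback.condition.symm)
    (fun s hs => by
      have := isIso_kernel_map_of_isPullback (IsPullback.of_hasPullback s.p
        ((fibFactorization C).factorizationData s.b).p).flip
      infer_instance)
    (fun s hs => by
      refine ⟨fun ⟨l, h₁, h₂⟩ => ⟨pullback.lift l
          ((fibFactorization C).factorizationData s.b).i (by simp [h₂]), ?_, ?_⟩,
        fun ⟨l, h₁, h₂⟩ => ⟨l ≫ pullback.fst _ _, ?_, ?_⟩⟩
      · apply pullback.hom_ext <;> simp [h₁]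
      · simp
      · rw [reassoc_of% h₁]; simp
      · rw [Category.assoc, pullback.condition, reassoc_of% h₂]; simp)
    (fun {s t} φ hs ht => by
      let ψ : Arrow.mk s.b ⟶ Arrow.mk t.b := Arrow.homMk (𝟙 B) φ.g (by simpa using φ.wb.symm)
      have h₁ : ((fibFactorization C).factorizationData s.b).i ≫ (fibFactorization C).mapZ ψ =
          ((fibFactorization C).factorizationData t.b).i := by
        rw [MorphismProperty.FunctorialFactorizationData.i_mapZ]; exact Category.id_comp _
      have h₂ : (fibFactorization C).mapZ ψ ≫ ((fibFactorization C).factorizationData t.b).p =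
          ((fibFactorization C).factorizationData s.b).p ≫ φ.g :=
        MorphismProperty.FunctorialFactorizationData.mapZ_p _ _
      refine ⟨⟨pullback.lift (pullback.fst _ _ ≫ φ.f)
        (pullback.snd _ _ ≫ (fibFactorization C).mapZ ψ) ?_, (fibFactorization C).mapZ ψ, ?_, ?_,
        h₁⟩, ?_⟩
      · rw [Category.assoc, Category.assoc, ← φ.w, h₂, pullback.condition_assoc]
      · simp
      · apply pullback.hom_ext
        · simp [φ.wa]
        · simp [h₁]
      · simp)

end ContractibleTarget

end

section

variable {C : Type u} [Category.{v} C] [ModelCategory C]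

/-! ### Replacement of lifting problems by cofibrant ones -/

section CofibrantProblems

variable [(cofibrations C).HasFunctorialFactorization (trivialFibrations C)]

variable (C) in
/-- The chosen functorial factorization into a cofibration and a trivial fibration. -/
noncomputable abbrev cofFactorization :
    MorphismProperty.FunctorialFactorizationData (cofibrations C) (trivialFibrations C) :=
  MorphismProperty.functorialFactorizationData _ _

variable {A B : C} {i : A ⟶ B}

namespace LiftingProblem

/-- The top morphism of a lifting problem after base change along the trivial fibration in the
factorization of its bottom morphism. -/
noncomputable abbrev cofibrantTop (s : LiftingProblem i) :
    A ⟶ pullback s.p ((cofFactorization C).factorizationData s.b).p :=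
  pullback.lift s.a (i ≫ ((cofFactorization C).factorizationData s.b).i) (by simp [s.w])

/-- The replacement of a lifting problem by one whose top and bottom morphisms
are cofibrations. -/
noncomputable abbrev cofibrantProblem (s : LiftingProblem i) : LiftingProblem i where
  X := ((cofFactorization C).factorizationData s.cofibrantTop).Z
  Y := ((cofFactorization C).factorizationData s.b).Z
  p := ((cofFactorization C).factorizationData s.cofibrantTop).p ≫ pullback.snd _ _
  a := ((cofFactorization C).factorizationData s.cofibrantTop).i
  b := ((cofFactorization C).factorizationData s.b).i
  w := by simp

/-- The comparison map from the replacement. -/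
noncomputable abbrev fromCofibrantProblem (s : LiftingProblem i) : s.cofibrantProblem.Hom s where
  f := ((cofFactorization C).factorizationData s.cofibrantTop).p ≫ pullback.fst _ _
  g := ((cofFactorization C).factorizationData s.b).p
  w := by simp [pullback.condition]
  wa := by simp
  wb := by simp

lemma Hom.exists_cofibrantProblem_hom {s t : LiftingProblem i} (φ : s.Hom t) :
    ∃ ψ : s.cofibrantProblem.Hom t.cofibrantProblem,
      ψ.f ≫ t.fromCofibrantProblem.f = s.fromCofibrantProblem.f ≫ φ.f := by
  let χ : Arrow.mk s.b ⟶ Arrow.mk t.b := Arrow.homMk (𝟙 B) φ.g (by simpa using φ.wb.symm)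
  have h₁ : ((cofFactorization C).factorizationData s.b).i ≫ (cofFactorization C).mapZ χ =
      ((cofFactorization C).factorizationData t.b).i := by
    rw [MorphismProperty.FunctorialFactorizationData.i_mapZ]; exact Category.id_comp _
  have h₂ : (cofFactorization C).mapZ χ ≫ ((cofFactorization C).factorizationData t.b).p =
      ((cofFactorization C).factorizationData s.b).p ≫ φ.g :=
    MorphismProperty.FunctorialFactorizationData.mapZ_p _ _
  let m : pullback s.p ((cofFactorization C).factorizationData s.b).p ⟶
      pullback t.p ((cofFactorization C).factorizationData t.b).p :=
    pullback.lift (pullback.fst _ _ ≫ φ.f) (pullback.snd _ _ ≫ (cofFactorization C).mapZ χ)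
      (by rw [Category.assoc, Category.assoc, ← φ.w, h₂, pullback.condition_assoc])
  have hm : s.cofibrantTop ≫ m = t.cofibrantTop := by
    apply pullback.hom_ext
    · simp [m, φ.wa]
    · simp [m, h₁]
  let ω : Arrow.mk s.cofibrantTop ⟶ Arrow.mk t.cofibrantTop :=
    Arrow.homMk (𝟙 A) m (by simpa using hm.symm)
  have h₃ : ((cofFactorization C).factorizationData s.cofibrantTop).i ≫
      (cofFactorization C).mapZ ω =
        ((cofFactorization C).factorizationData t.cofibrantTop).i := by
    rw [MorphismProperty.FunctorialFactorizationData.i_mapZ]; exact Category.id_comp _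
  have h₄ : (cofFactorization C).mapZ ω ≫
      ((cofFactorization C).factorizationData t.cofibrantTop).p =
        ((cofFactorization C).factorizationData s.cofibrantTop).p ≫ m :=
    MorphismProperty.FunctorialFactorizationData.mapZ_p _ _
  refine ⟨⟨(cofFactorization C).mapZ ω, (cofFactorization C).mapZ χ, ?_, h₃, h₁⟩, ?_⟩
  · rw [reassoc_of% h₄]; simp [m]
  · rw [reassoc_of% h₄]; simp [m]

end LiftingProblem

variable [HasZeroObject C] [HasZeroMorphisms C]

/-- The lifting problems against fibrations with fibrant target in which the two morphisms out of
`i` are cofibrations. -/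
def cofibrantProblems (i : A ⟶ B) : LiftingProblem i → Prop :=
  fun s => fibrationProblems (fun Y => IsFibrant Y) i s ∧ Cofibration s.a ∧ Cofibration s.b

/-- For the existence of a fibrant obstruction theory it suffices to treat lifting problems whose
top and bottom morphisms are cofibrations. -/
noncomputable def ObstructionOn.ofCofibrantProblems [Cofibration i]
    (O : ObstructionOn (cofibrantProblems i)) :
    ObstructionOn (fibrationProblems (fun Y => IsFibrant Y) i) :=
  O.ofReplacement' LiftingProblem.cofibrantProblem
    (fun s hs => by
      have := hs.1
      exact ⟨⟨inferInstance, fibrant_of_fibration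
        ((cofFactorization C).factorizationData s.b).p inferInstance hs.2⟩,
        inferInstance, inferInstance⟩)
    (fun s => s.fromCofibrantProblem.f) (fun s => s.fromCofibrantProblem.g)
    (fun s => s.fromCofibrantProblem.w)
    (fun s hs => by
      have := hs.1
      exact weakEquivalence_kernelMap _)
    (fun s hs => by
      have := hs.1
      exact s.fromCofibrantProblem.solvable_iff.symm)
    (fun φ _ _ => φ.exists_cofibrantProblem_hom)

end CofibrantProblems

variable [HasZeroObject C] [HasZeroMorphisms C]

/-! ### Functorial replacement by fibrations with fibrant target -/

section FibrantReplacement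

variable [(trivialCofibrations C).HasFunctorialFactorization (fibrations C)]

/-- The functorial fibrant replacement of an object. -/
noncomputable abbrev fibrantObject (Y : C) : C :=
  ((fibFactorization C).factorizationData (0 : Y ⟶ (0 : C))).Z

/-- The inclusion into the fibrant replacement, which is a trivial cofibration. -/
noncomputable abbrev toFibrantObject (Y : C) : Y ⟶ fibrantObject Y :=
  ((fibFactorization C).factorizationData (0 : Y ⟶ (0 : C))).i

lemma isFibrant_fibrantObject (Y : C) : IsFibrant (fibrantObject Y) :=
  fibrant_of_fibration ((fibFactorization C).factorizationData (0 : Y ⟶ (0 : C))).p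
    inferInstance isFibrant_zero

/-- The functorial replacement of a morphism by a fibration with fibrant target, encoded as a
factorization of its composite with the fibrant replacement of the target. -/
noncomputable abbrev fibrantReplacement {X Y : C} (p : X ⟶ Y) :
    MorphismProperty.MapFactorizationData (trivialCofibrations C) (fibrations C)
      (p ≫ toFibrantObject Y) :=
  (fibFactorization C).factorizationData (p ≫ toFibrantObject Y)

lemma exists_fibrantReplacement_map {X Y X' Y' : C} {p : X ⟶ Y} {p' : X' ⟶ Y'} {f : X ⟶ X'}
    {g : Y ⟶ Y'} (w : p ≫ g = f ≫ p') :
    ∃ (f' : (fibrantReplacement p).Z ⟶ (fibrantReplacement p').Z)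
      (g' : fibrantObject Y ⟶ fibrantObject Y'),
      (fibrantReplacement p).p ≫ g' = f' ≫ (fibrantReplacement p').p ∧
        (fibrantReplacement p).i ≫ f' = f ≫ (fibrantReplacement p').i ∧
          toFibrantObject Y ≫ g' = g ≫ toFibrantObject Y' := by
  let χ : Arrow.mk (0 : Y ⟶ (0 : C)) ⟶ Arrow.mk (0 : Y' ⟶ (0 : C)) :=
    Arrow.homMk g (𝟙 _) (by simp)
  have h₁ : toFibrantObject Y ≫ (fibFactorization C).mapZ χ = g ≫ toFibrantObject Y' :=
    (fibFactorization C).i_mapZ χ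
  let ω : Arrow.mk (p ≫ toFibrantObject Y) ⟶ Arrow.mk (p' ≫ toFibrantObject Y') :=
    Arrow.homMk f ((fibFactorization C).mapZ χ) (by
      change f ≫ p' ≫ _ = (p ≫ _) ≫ _
      rw [Category.assoc, h₁, reassoc_of% w])
  exact ⟨(fibFactorization C).mapZ ω, (fibFactorization C).mapZ χ,
    ((fibFactorization C).mapZ_p ω).symm, (fibFactorization C).i_mapZ ω, h₁⟩

end FibrantReplacement

/-! ### Cobase change of lifting problems along weak equivalences -/

section Pushout

variable [(trivialCofibrations C).HasFunctorialFactorization (fibrations C)]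

variable {A B A' B' : C} {i : A ⟶ B} {i' : A' ⟶ B'}

namespace LiftingProblem

/-- The map between the pushouts of the top and of the bottom morphism of a lifting problem. -/
noncomputable abbrev pushoutMap (s : LiftingProblem i) (u : A ⟶ A') (v : B ⟶ B')
    (w : i ≫ v = u ≫ i') : pushout s.a u ⟶ pushout s.b v :=
  pushout.desc (s.p ≫ pushout.inl _ _) (i' ≫ pushout.inr _ _)
    (by rw [reassoc_of% s.w, pushout.condition, reassoc_of% w])

/-- The lifting problem for `i'` that is obtained from one for `i` by cobase change along
`(u, v) : i ⟶ i'` and replacement by a fibration with fibrant target. -/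
noncomputable abbrev pushoutProblem (s : LiftingProblem i) (u : A ⟶ A') (v : B ⟶ B')
    (w : i ≫ v = u ≫ i') : LiftingProblem i' where
  X := (fibrantReplacement (s.pushoutMap u v w)).Z
  Y := fibrantObject (pushout s.b v)
  p := (fibrantReplacement (s.pushoutMap u v w)).p
  a := pushout.inr _ _ ≫ (fibrantReplacement (s.pushoutMap u v w)).i
  b := pushout.inr _ _ ≫ toFibrantObject _
  w := by simp

/-- The comparison map to the cobase change, as a morphism of lifting problems for `i`. -/
noncomputable abbrev toPushoutProblem (s : LiftingProblem i) (u : A ⟶ A') (v : B ⟶ B')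
    (w : i ≫ v = u ≫ i') : s.Hom ((s.pushoutProblem u v w).precomp u v w) where
  f := pushout.inl _ _ ≫ (fibrantReplacement (s.pushoutMap u v w)).i
  g := pushout.inl _ _ ≫ toFibrantObject _
  w := by simp
  wa := by simp [pushout.condition_assoc]
  wb := by simp [pushout.condition_assoc]

lemma Hom.exists_pushoutProblem_hom {s t : LiftingProblem i} (φ : s.Hom t) (u : A ⟶ A')
    (v : B ⟶ B') (w : i ≫ v = u ≫ i') :
    ∃ ψ : (s.pushoutProblem u v w).Hom (t.pushoutProblem u v w),
      φ.f ≫ (t.toPushoutProblem u v w).f = (s.toPushoutProblem u v w).f ≫ ψ.f := by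
  let m : pushout s.a u ⟶ pushout t.a u :=
    pushout.desc (φ.f ≫ pushout.inl _ _) (pushout.inr _ _)
      (by rw [reassoc_of% φ.wa, pushout.condition])
  let n : pushout s.b v ⟶ pushout t.b v :=
    pushout.desc (φ.g ≫ pushout.inl _ _) (pushout.inr _ _)
      (by rw [reassoc_of% φ.wb, pushout.condition])
  have hmn : s.pushoutMap u v w ≫ n = m ≫ t.pushoutMap u v w := by
    apply pushout.hom_ext
    · simp [m, n, reassoc_of% φ.w]
    · simp [m, n]
  obtain ⟨f', g', h₁, h₂, h₃⟩ := exists_fibrantReplacement_map hmn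
  refine ⟨⟨f', g', h₁, ?_, ?_⟩, ?_⟩
  · rw [Category.assoc, h₂]; simp [m]
  · rw [Category.assoc, h₃]; simp [n]
  · rw [Category.assoc, h₂]; simp [m]

end LiftingProblem

variable [(cofibrations C).HasFunctorialFactorization (trivialFibrations C)] [IsLeftProper C]

/-- In a left proper model category, fibrant obstruction theories can be pulled back along a weak
equivalence of cofibrations `(u, v) : i ⟶ i'`. -/
noncomputable def ObstructionOn.ofWeakEquivalence [Cofibration i] [Cofibration i']
    (O : ObstructionOn (fibrationProblems (fun Y => IsFibrant Y) i')) (u : A ⟶ A') (v : B ⟶ B')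
    (w : i ≫ v = u ≫ i') [WeakEquivalence u] [WeakEquivalence v] :
    ObstructionOn (fibrationProblems (fun Y => IsFibrant Y) i) :=
  ofCofibrantProblems <|
    have h (s : LiftingProblem i) (hs : cofibrantProblems i s) :
        WeakEquivalence (s.toPushoutProblem u v w).f ∧
          WeakEquivalence (pullback.fst (s.pushoutProblem u v w).p
            (s.toPushoutProblem u v w).g) := by
      obtain ⟨⟨_, hY⟩, _, _⟩ := hs
      have := weakEquivalence_inl_pushout s.a u
      have := weakEquivalence_inl_pushout s.b v
      exact ⟨inferInstance, weakEquivalence_of_isPullback_of_isFibrant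
        (IsPullback.of_hasPullback _ _) inferInstance inferInstance
          (isFibrant_fibrantObject _) hY⟩
    O.ofReplacement (fun s => s.pushoutProblem u v w)
      (fun s hs => ⟨inferInstance, isFibrant_fibrantObject _⟩)
      (fun s => (s.toPushoutProblem u v w).f) (fun s => (s.toPushoutProblem u v w).g)
      (fun s => (s.toPushoutProblem u v w).w)
      (fun s hs => by
        have := hs.1.1
        obtain ⟨_, _⟩ := h s hs
        exact weakEquivalence_kernelMap _)
      (fun s hs => by
        have := hs.1.1
        obtain ⟨_, h₂⟩ := h s hs
        have : Fibration ((s.pushoutProblem u v w).precomp u v w).p :=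
          inferInstanceAs (Fibration (fibrantReplacement (s.pushoutMap u v w)).p)
        have : WeakEquivalence (pullback.fst ((s.pushoutProblem u v w).precomp u v w).p
          (s.toPushoutProblem u v w).g) := h₂
        rw [(s.toPushoutProblem u v w).solvable_iff]
        exact (s.pushoutProblem u v w).solvable_precomp_iff u v w)
      (fun φ _ _ => φ.exists_pushoutProblem_hom u v w)

end Pushout

/-! ### Right proper model categories -/

section RightProper

variable [(trivialCofibrations C).HasFunctorialFactorization (fibrations C)]

/-- In a right proper model category, a fibrant obstruction theory extends to an obstruction
theory. -/
noncomputable def ObstructionOn.ofFibrant [IsRightProper C] {A B : C} {i : A ⟶ B} [Cofibration i]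
    (O : ObstructionOn (fibrationProblems (fun Y => IsFibrant Y) i)) :
    ObstructionOn (fibrationProblems (fun _ => True) i) :=
  have h {X Y : C} (p : X ⟶ Y) :
      WeakEquivalence (pullback.fst (fibrantReplacement p).p (toFibrantObject Y)) :=
    IsRightProper.weakEquivalence_of_isPullback (IsPullback.of_hasPullback _ _) inferInstance
      inferInstance
  O.ofReplacement
    (fun s =>
      { X := (fibrantReplacement s.p).Z
        Y := fibrantObject s.Y
        p := (fibrantReplacement s.p).p
        a := s.a ≫ (fibrantReplacement s.p).i
        b := s.b ≫ toFibrantObject _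
        w := by simp [reassoc_of% s.w] })
    (fun s hs => ⟨inferInstance, isFibrant_fibrantObject _⟩)
    (fun s => (fibrantReplacement s.p).i) (fun s => toFibrantObject s.Y) (fun s => by simp)
    (fun s hs => by
      have := hs.1
      have := h s.p
      exact weakEquivalence_kernelMap _)
    (fun s hs => by
      have := hs.1
      have := h s.p
      exact LiftingProblem.Hom.solvable_iff ⟨(fibrantReplacement s.p).i, toFibrantObject s.Y,
        by simp, rfl, rfl⟩)
    (fun {s t} φ hs ht => by
      obtain ⟨f', g', h₁, h₂, h₃⟩ := exists_fibrantReplacement_map φ.w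
      refine ⟨⟨f', g', h₁, ?_, ?_⟩, h₂.symm⟩
      · change (s.a ≫ _) ≫ f' = t.a ≫ _
        rw [Category.assoc, h₂, reassoc_of% φ.wa]
      · change (s.b ≫ _) ≫ g' = t.b ≫ _
        rw [Category.assoc, h₃, reassoc_of% φ.wb])

end RightProper

end

section

variable {C : Type u} [Category.{v} C] [ModelCategory C] [HasZeroMorphisms C]

/-! ### Closure properties -/

section Closure

lemma WeaklyEquivalent.of_square {C : Type u} [Category.{v} C] [ModelCategory C]
    {A A' B B' : C} {i : A ⟶ B} {i' : A' ⟶ B'} (u : A ⟶ A') (v : B ⟶ B') (w : i ≫ v = u ≫ i')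
    [hu : WeakEquivalence u] [hv : WeakEquivalence v] : WeaklyEquivalent i i' :=
  .rel _ _ ⟨Arrow.homMk u v w.symm, hu, hv⟩

/-- The existence of an obstruction theory for lifting problems against fibrations with
fibrant target. -/
abbrev HasFibrantObstruction {A B : C} (i : A ⟶ B) : Prop :=
  Nonempty (ObstructionOn (fibrationProblems (fun Y => IsFibrant Y) i))

lemma HasFibrantObstruction.of_isPushout {A A' B B' : C} {f : A ⟶ A'} {i : A ⟶ B}
    {i' : A' ⟶ B'} {g : B ⟶ B'} (h : HasFibrantObstruction i) (sq : IsPushout f i i' g) :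
    HasFibrantObstruction i' := by
  obtain ⟨O⟩ := h
  exact ⟨O.precomp f g sq.w.symm (fun s hs => hs) fun s _ ⟨l, h₁, h₂⟩ =>
    ⟨sq.desc s.a l h₁.symm, sq.inl_desc _ _ _,
      sq.hom_ext (by rw [sq.inl_desc_assoc, s.w]) (by rw [sq.inr_desc_assoc, h₂])⟩⟩

lemma HasFibrantObstruction.of_retract {A A' B B' : C} {i : A ⟶ B} {i' : A' ⟶ B'}
    (h : HasFibrantObstruction i) (r : RetractArrow i' i) : HasFibrantObstruction i' := by
  obtain ⟨O⟩ := h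
  refine ⟨O.precomp r.r.left r.r.right r.r.w.symm (fun s hs => hs) fun s _ ⟨l, h₁, h₂⟩ =>
    ⟨r.i.right ≫ l, ?_, ?_⟩⟩
  · have := r.i.w
    dsimp at this
    rw [← reassoc_of% this, h₁, r.retract_left_assoc]
    exact Category.id_comp _
  · rw [Category.assoc, h₂, r.retract_right_assoc]
    exact Category.id_comp _

variable [HasZeroObject C] [(trivialCofibrations C).HasFunctorialFactorization (fibrations C)]
  [IsLeftProper C]

lemma HasFibrantObstruction.of_isWeaklyContractible {A B : C} {i : A ⟶ B} [Cofibration i]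
    (hB : IsWeaklyContractible B) : HasFibrantObstruction i := by
  let d := MorphismProperty.factorizationData (cofibrations C) (trivialFibrations C) (initial.to A)
  let e := MorphismProperty.factorizationData (cofibrations C) (trivialFibrations C) (d.p ≫ i)
  have : IsCofibrant d.Z :=
    (isCofibrant_iff_of_isInitial d.i initialIsInitial).2 inferInstance
  have O := obstructionOnOfIsWeaklyContractible (i := e.i)
    (isWeaklyContractible_of_weakEquivalence e.p hB)
  refine ⟨O.precomp d.p e.p e.fac (fun s hs => hs) fun s hs h => ?_⟩
  have := hs.1
  exact (s.solvable_precomp_iff d.p e.p e.fac).1 h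

variable [(cofibrations C).HasFunctorialFactorization (trivialFibrations C)]

lemma hasFibrantObstruction_iff_of_weakEquivalence {A A' B B' : C} {i : A ⟶ B} {i' : A' ⟶ B'}
    [Cofibration i] [Cofibration i'] (u : A ⟶ A') (v : B ⟶ B') (w : i ≫ v = u ≫ i')
    [WeakEquivalence u] [WeakEquivalence v] :
    HasFibrantObstruction i ↔ HasFibrantObstruction i' := by
  refine ⟨fun ⟨O⟩ => ⟨O.precomp u v w (fun s hs => hs) fun s hs h => ?_⟩,
    fun ⟨O⟩ => ⟨O.ofWeakEquivalence u v w⟩⟩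
  have := hs.1
  exact (s.solvable_precomp_iff u v w).1 h

variable (C) in
/-- The morphisms that have a fibrant obstruction theory after replacement by a cofibration.
In contrast to the cofibrations with a fibrant obstruction theory, this class can be followed
along zigzags of arbitrary morphisms. -/
def obstructedMorphisms : MorphismProperty C := fun _ _ f =>
  HasFibrantObstruction
    (MorphismProperty.factorizationData (cofibrations C) (trivialFibrations C) f).i

lemma hasFibrantObstruction_iff_obstructedMorphisms {A A' Z B' : C} (j : A ⟶ Z) [Cofibration j]
    (f : A' ⟶ B') (u : A ⟶ A') (z : Z ⟶ B') (w : j ≫ z = u ≫ f) [WeakEquivalence u]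
    [WeakEquivalence z] : HasFibrantObstruction j ↔ obstructedMorphisms C f := by
  let d := MorphismProperty.factorizationData (cofibrations C) (trivialFibrations C) f
  have sq : CommSq (u ≫ d.i) j d.p z := ⟨by simp [w]⟩
  have : WeakEquivalence sq.lift := weakEquivalence_of_postcomp_of_fac sq.fac_right
  exact hasFibrantObstruction_iff_of_weakEquivalence u sq.lift sq.fac_left

lemma obstructedMorphisms_iff_of_weaklyEquivalent {A A' B B' : C} {i : A ⟶ B} {i' : A' ⟶ B'}
    (h : WeaklyEquivalent i i') : obstructedMorphisms C i ↔ obstructedMorphisms C i' := by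
  have key (f g : Arrow C) (h : Relation.EqvGen
      (fun f g : Arrow C => ∃ φ : f ⟶ g, WeakEquivalence φ.left ∧ WeakEquivalence φ.right) f g) :
      obstructedMorphisms C f.hom ↔ obstructedMorphisms C g.hom := by
    induction h with
    | rel f g h =>
      obtain ⟨φ, _, _⟩ := h
      exact hasFibrantObstruction_iff_obstructedMorphisms _ g.hom φ.left
        ((MorphismProperty.factorizationData (cofibrations C) (trivialFibrations C) f.hom).p ≫
          φ.right) (by simp)
    | refl => rfl
    | symm _ _ _ h => exact h.symm
    | trans _ _ _ _ _ h h' => exact h.trans h'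
  exact key _ _ h

lemma HasFibrantObstruction.of_weaklyEquivalent {A A' B B' : C} {i : A ⟶ B} {i' : A' ⟶ B'}
    [Cofibration i] [Cofibration i'] (h : HasFibrantObstruction i) (e : WeaklyEquivalent i i') :
    HasFibrantObstruction i' := by
  have h₁ := hasFibrantObstruction_iff_obstructedMorphisms i i (𝟙 _) (𝟙 _) (by simp)
  have h₂ := hasFibrantObstruction_iff_obstructedMorphisms i' i' (𝟙 _) (𝟙 _) (by simp)
  rw [h₂, ← obstructedMorphisms_iff_of_weaklyEquivalent e, ← h₁]
  exact h

/-- The generated cofibrations are cofibrations and have a fibrant obstruction theory. -/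
lemma generatedCofibrations.cofibration_and_hasFibrantObstruction {A B : C} {i : A ⟶ B}
    (h : generatedCofibrations C i) : Cofibration i ∧ HasFibrantObstruction i := by
  induction h with
  | of_isWeaklyContractible i hi hB => exact ⟨hi, .of_isWeaklyContractible hB⟩
  | of_weaklyEquivalent i i' _ hi' e ih =>
    obtain ⟨_, h⟩ := ih
    exact ⟨hi', h.of_weaklyEquivalent e⟩
  | of_isPushout f i i' g _ sq ih =>
    obtain ⟨_, h⟩ := ih
    exact ⟨(cofibration_iff _).2 (MorphismProperty.of_isPushout (P := cofibrations C) sq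
      (mem_cofibrations i)), h.of_isPushout sq⟩
  | of_retract i i' _ r ih =>
    obtain ⟨_, h⟩ := ih
    exact ⟨(cofibration_iff _).2 (MorphismProperty.of_retract (P := cofibrations C) r
      (mem_cofibrations i)), h.of_retract r⟩

end Closure

/-! ### The universal lifting problem -/

section Universal

variable [HasZeroObject C]

/-- A cofibration that has an obstruction theory for a class of fibrations which includes those
with its own target as target is a retract of a principal cofibration. -/
lemma ObstructionOn.mem_retracts_principalCofibrations {T : ObjectProperty C} {A B : C}
    {i : A ⟶ B} [Cofibration i] (O : ObstructionOn (fibrationProblems T i)) (hB : T B) :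
    (principalCofibrations C).retracts i := by
  let d := MorphismProperty.factorizationData (trivialCofibrations C) (fibrations C) i
  let s : LiftingProblem i := ⟨d.p, d.i, 𝟙 B, by simp⟩
  have hs : fibrationProblems T i s := ⟨inferInstanceAs (Fibration d.p), hB⟩
  -- A cofibrant replacement of the source of the obstruction classes, so that the
  -- obstruction of `s` is represented by a morphism `o`, and a cone on it.
  let V := MorphismProperty.factorizationData (cofibrations C) (trivialFibrations C)
    (initial.to O.W)
  have : IsCofibrant V.Z :=
    (isCofibrant_iff_of_isInitial V.i initialIsInitial).2 inferInstance
  have : IsFibrant (kernel d.p) := isFibrant_kernel d.p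
  obtain ⟨o, ho⟩ := map_surjective_of_isLocalization (weakEquivalences C).Q V.Z (kernel d.p)
    ((weakEquivalences C).Q.map V.p ≫ O.obs s hs)
  let K := MorphismProperty.factorizationData (cofibrations C) (trivialFibrations C)
    (0 : V.Z ⟶ (0 : C))
  have hK : IsWeaklyContractible K.Z := by
    have : K.p = 0 := (isZero_zero C).eq_of_tgt _ _
    rw [IsWeaklyContractible, ← this]
    infer_instance
  let j : d.Z ⟶ pushout (o ≫ kernel.ι d.p) K.i := pushout.inl _ _
  have hj : principalCofibrations C j :=
    .of_isPushout _ _ _ _ (.of_isWeaklyContractible K.i inferInstance hK)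
      (IsPushout.of_hasPushout _ _)
  let e := MorphismProperty.factorizationData (trivialCofibrations C) (fibrations C)
    (pushout.desc d.p 0 (by simp) : pushout (o ≫ kernel.ι d.p) K.i ⟶ B)
  have he : j ≫ e.i ≫ e.p = d.p := by simp [j]
  let t : LiftingProblem i := ⟨e.p, d.i ≫ j ≫ e.i, 𝟙 B, by
    rw [Category.assoc, Category.assoc, he, d.fac, Category.comp_id]⟩
  have ht : fibrationProblems T i t := ⟨inferInstanceAs (Fibration e.p), hB⟩
  let φ : s.Hom t := ⟨j ≫ e.i, 𝟙 B, by
    rw [Category.assoc, he]; exact Category.comp_id _, rfl, Category.comp_id _⟩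
  have hφ : o ≫ φ.kernelMap =
      K.i ≫ kernel.lift e.p (pushout.inr (o ≫ kernel.ι d.p) K.i ≫ e.i) (by simp) := by
    rw [← cancel_mono (kernel.ι _)]
    have := pushout.condition_assoc (f := o ≫ kernel.ι d.p) (g := K.i) e.i
    simpa [φ, s, t, j] using this
  -- The obstruction of `t` factors through the contractible cone.
  have hobs : O.obs t ht = (weakEquivalences C).Q.map 0 := by
    rw [← cancel_epi ((weakEquivalences C).Q.map V.p), O.functorial φ hs ht, ← Category.assoc,
      ← ho, ← Functor.map_comp, hφ, Functor.map_comp, Q_map_eq_of_isWeaklyContractible hK,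
      ← Functor.map_comp, ← Functor.map_comp, comp_zero, comp_zero]
  obtain ⟨l, h₁, h₂⟩ := (O.solvable_iff t ht).2 hobs
  let k := MorphismProperty.factorizationData (cofibrations C) (trivialFibrations C)
    (d.i ≫ j ≫ e.i)
  have hk : principalCofibrations C k.i := by
    have h₁ : WeaklyEquivalent j (j ≫ e.i) := .of_square (𝟙 _) e.i (by simp)
    have h₂ : WeaklyEquivalent (d.i ≫ j ≫ e.i) (j ≫ e.i) := .of_square d.i (𝟙 _) (by simp)
    have h₃ : WeaklyEquivalent k.i (d.i ≫ j ≫ e.i) := .of_square (𝟙 _) k.p (by simp)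
    exact .of_weaklyEquivalent j k.i hj inferInstance
      (h₁.trans _ _ _ (h₂.symm _ _ |>.trans _ _ _ (h₃.symm _ _)))
  have sq : CommSq k.i i k.p l := ⟨by rw [k.fac, h₁]⟩
  have hr : k.i ≫ k.p ≫ e.p = i := by
    rw [k.fac_assoc, Category.assoc, Category.assoc, he, d.fac]
  have hl : sq.lift ≫ k.p ≫ e.p = 𝟙 B := by
    rw [sq.fac_right_assoc]
    exact h₂
  exact ⟨_, _, k.i,
    { i := Arrow.homMk (𝟙 A) sq.lift (by simp)
      r := Arrow.homMk (𝟙 A) (k.p ≫ e.p) (by simpa using hr.symm)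
      retract := Arrow.hom_ext _ _ (Category.comp_id _) hl }, hk⟩

lemma principalCofibrations_le_generatedCofibrations :
    principalCofibrations C ≤ generatedCofibrations C := by
  intro A B i h
  induction h with
  | of_isWeaklyContractible i hi hB => exact .of_isWeaklyContractible i hi hB
  | of_weaklyEquivalent i i' _ hi' e ih => exact .of_weaklyEquivalent i i' ih hi' e
  | of_isPushout f i i' g _ sq ih => exact .of_isPushout f i i' g ih sq

lemma retracts_principalCofibrations_le_generatedCofibrations :
    (principalCofibrations C).retracts ≤ generatedCofibrations C := by
  rintro A B i ⟨_, _, j, r, hj⟩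
  exact .of_retract j i (principalCofibrations_le_generatedCofibrations _ hj) r

lemma HasFibrantObstruction.generatedCofibrations [IsLeftProper C] {A B : C} {i : A ⟶ B}
    [Cofibration i] (h : HasFibrantObstruction i) : generatedCofibrations C i := by
  obtain ⟨O⟩ := h
  let d := MorphismProperty.factorizationData (trivialCofibrations C) (fibrations C)
    (0 : B ⟶ (0 : C))
  have O' : ObstructionOn (fibrationProblems (fun Y => IsFibrant Y) (i ≫ d.i)) :=
    O.precomp (𝟙 A) d.i (by simp) (fun s hs => hs) fun s hs h => by
      have := hs.1
      exact (s.solvable_precomp_iff (𝟙 A) d.i (by simp)).1 h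
  exact .of_weaklyEquivalent (i ≫ d.i) i
    (retracts_principalCofibrations_le_generatedCofibrations _
      (O'.mem_retracts_principalCofibrations
        (fibrant_of_fibration d.p inferInstance isFibrant_zero))) inferInstance
    (.symm _ _ (WeaklyEquivalent.of_square (𝟙 A) d.i (by simp)))

end Universal

end

end ObstructionTheory

theorem theorem7p2 (C : Type u) [Category.{v} C] [ModelCategory C]
    [(cofibrations C).HasFunctorialFactorization (trivialFibrations C)]
    [(trivialCofibrations C).HasFunctorialFactorization (fibrations C)]
    [HasZeroObject C] [HasZeroMorphisms C] [ObstructionTheory.IsLeftProper C] :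
    ObstructionTheory.generatedCofibrations C =
        ObstructionTheory.cofibrationsWithFibrantObstructionTheory C ∧
      (ObstructionTheory.IsRightProper C →
        ObstructionTheory.generatedCofibrations C =
            ObstructionTheory.cofibrationsWithObstructionTheory C ∧
          ObstructionTheory.cofibrationsWithObstructionTheory C =
            (ObstructionTheory.principalCofibrations C).retracts) := by
  have hK : ObstructionTheory.generatedCofibrations C =
      ObstructionTheory.cofibrationsWithFibrantObstructionTheory C := by
    refine le_antisymm (fun A B i h => ?_) (fun A B i h => ?_)
    · obtain ⟨hi, ho⟩ := h.cofibration_and_hasFibrantObstruction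
      exact ⟨hi, ObstructionTheory.nonempty_obstructionData_iff.2 ho⟩
    · obtain ⟨_, ho⟩ := h
      exact ObstructionTheory.HasFibrantObstruction.generatedCofibrations
        (ObstructionTheory.nonempty_obstructionData_iff.1 ho)
  refine ⟨hK, fun _ => ?_⟩
  have h₁ : ObstructionTheory.generatedCofibrations C ≤
      ObstructionTheory.cofibrationsWithObstructionTheory C := by
    rw [hK]
    rintro A B i ⟨hi, ho⟩
    obtain ⟨O⟩ := ObstructionTheory.nonempty_obstructionData_iff.1 ho
    exact ⟨hi, ⟨O.ofFibrant.toObstructionData⟩⟩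
  have h₂ : ObstructionTheory.cofibrationsWithObstructionTheory C ≤
      (ObstructionTheory.principalCofibrations C).retracts := by
    rintro A B i ⟨hi, ⟨O⟩⟩
    exact O.toObstructionOn.mem_retracts_principalCofibrations trivial
  have h₃ := ObstructionTheory.retracts_principalCofibrations_le_generatedCofibrations (C := C)
  exact ⟨le_antisymm h₁ (h₂.trans h₃), le_antisymm h₂ (h₃.trans h₁)⟩
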